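/- Let $V(\mathbb Z)$ be a lattice (a free abelian group of finite rank), $V(\mathbb Q)=V(\mathbb Z)\otimes\mathbb Q$ and $V=V(\mathbb Q)\otimes\mathbb R$. A polyhedral cone (resp. rational polyhedral cone) is the set of all nonnegative real combinations of finitely many vectors (resp. of finitely many vectors in $V(\mathbb Q)$). Let $\Gamma$ be a group and $\rho\colon\Gamma\to \mathrm{GL}(V)$ a homomorphism such that the resulting action leaves invariant some lattice in $V(\mathbb Q)$ of full rank and a non-empty open convex cone $C\subset V$. Put $C_+=\mathrm{Conv}(\overline C\cap V(\mathbb Q))$, the convex hull of the rational points of $\overline C$. Let $W$ be the maximal real vector subspace of $V$ contained in $\overline C$ (it is $\Gamma$-invariant), and suppose that $W$ is defined over $\mathbb Q$, that is, $W$ is spanned over $\mathbb R$ by $W\cap V(\mathbb Q)$. Equip $V/W$ with the lattice that is the image of $V(\mathbb Z)$, let $\widetilde C$ be the image of $C$ in $V/W$, let $\widetilde C_+$ be the convex hull of the rational points of the closure of $\widetilde C$, and let $\widetilde\Gamma$ be the image of $\Gamma\to\mathrm{GL}(V/W)$. Suppose that $(\widetilde C_+,\widetilde\Gamma)$ is of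 polyhedral type, that is, there is a polyhedral cone $\widetilde Q\subset\widetilde C_+$ with $\widetilde\Gamma\cdot\widetilde Q\supset\widetilde C$. Then there is a rational polyhedral cone $\Pi\subset C_+$ such that $\Gamma\cdot\Pi=C_+$ and, for each $\gamma\in\Gamma$, either $\gamma\Pi\cap\mathrm{Int}(\Pi)=\emptyset$ or $\gamma\Pi=\Pi$, where $\mathrm{Int}$ denotes the relative interior. Moreover, $$\{\gamma\in\Gamma\mid\gamma\Pi=\Pi\}=\{\gamma\in\Gamma\mid\gamma\text{ acts trivially on }V/W\}.$$ -/

import Mathlib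

/-- The rational points `L ⊗ ℚ` of a vector space with lattice `L`: the vectors having a positive
integral multiple in `L`. -/
def ratPoints {E : Type*} [AddCommGroup E] (L : Submodule ℤ E) : Set E :=
  {v | ∃ n : ℕ, 0 < n ∧ n • v ∈ L}

/-- A polyhedral cone: the set of all nonnegative real combinations of finitely many vectors. -/
def IsPolyhedralCone {E : Type*} [AddCommGroup E] [Module ℝ E] (P : Set E) : Prop :=
  ∃ s : Finset E, P = (PointedCone.hull ℝ (s : Set E) : Set E)

/-- A rational polyhedral cone: the generators can be chosen to be rational. -/
def IsRationalPolyhedralCone {E : Type*} [AddCommGroup E] [Module ℝ E] (L : Submodule ℤ E)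
    (P : Set E) : Prop :=
  ∃ s : Finset E, (s : Set E) ⊆ ratPoints L ∧ P = (PointedCone.hull ℝ (s : Set E) : Set E)

/-- `C₊`: the convex hull of the rational points of the closure of `C`. -/
def conePlus {E : Type*} [AddCommGroup E] [Module ℝ E] [TopologicalSpace E] (L : Submodule ℤ E)
    (C : Set E) : Set E :=
  convexHull ℝ (closure C ∩ ratPoints L)

/-- `(C₊, Γ)` is of polyhedral type, where `Γ` acts through `ρ`. -/
def IsPolyhedralType {E : Type*} [AddCommGroup E] [Module ℝ E] [TopologicalSpace E]
    (L : Submodule ℤ E) (C : Set E) {Γ : Type*} [Group Γ] (ρ : Γ →* (E ≃ₗ[ℝ] E)) : Prop :=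
  ∃ P : Set E, IsPolyhedralCone P ∧ P ⊆ conePlus L C ∧ C ⊆ ⋃ γ : Γ, ρ γ '' P

/-- `W` is the maximal vector space contained in the closure of `C`. -/
def IsMaximalSubspace {E : Type*} [AddCommGroup E] [Module ℝ E] [TopologicalSpace E]
    (C : Set E) (W : Submodule ℝ E) : Prop :=
  IsGreatest {U : Submodule ℝ E | (U : Set E) ⊆ closure C} W

/-- A real subspace `W` is defined over `ℚ` if it is spanned by its rational points. -/
def IsDefinedOverRat {E : Type*} [AddCommGroup E] [Module ℝ E] (L : Submodule ℤ E)
    (W : Submodule ℝ E) : Prop :=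
  Submodule.span ℝ ((W : Set E) ∩ ratPoints L) = W

/-- The lattice of `E ⧸ W` induced by `L`: the image of `L`. -/
def quotientLattice {E : Type*} [AddCommGroup E] [Module ℝ E] (L : Submodule ℤ E)
    (W : Submodule ℝ E) : Submodule ℤ (E ⧸ W) :=
  L.map (W.mkQ.restrictScalars ℤ)

/-- The maximal vector space in the closure of an invariant set is invariant. -/
theorem IsMaximalSubspace.map_eq {E : Type*} [NormedAddCommGroup E] [NormedSpace ℝ E]
    [FiniteDimensional ℝ E] {Γ : Type*} [Group Γ] {ρ : Γ →* (E ≃ₗ[ℝ] E)} {C : Set E}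
    {W : Submodule ℝ E} (hW : IsMaximalSubspace C W) (hC : ∀ γ, ρ γ '' C = C) (γ : Γ) :
    W.map (ρ γ : E →ₗ[ℝ] E) = W := by
  have key : ∀ γ, W.map (ρ γ : E →ₗ[ℝ] E) ≤ W := by
    intro γ
    apply hW.2
    rintro _ ⟨x, hx, rfl⟩
    have h := image_closure_subset_closure_image
      (LinearMap.continuous_of_finiteDimensional (ρ γ : E →ₗ[ℝ] E)) (s := C)
      ⟨x, hW.1 hx, rfl⟩
    have h2 : (ρ γ : E →ₗ[ℝ] E) '' C = C := hC γ
    rwa [h2] at h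
  refine le_antisymm (key γ) fun x hx => ?_
  refine ⟨ρ γ⁻¹ x, key γ⁻¹ ⟨x, hx, rfl⟩, ?_⟩
  change (ρ γ * ρ γ⁻¹) x = x
  rw [← map_mul]
  simp

/-- The action on `E ⧸ W` induced by an action on `E` which leaves `W` invariant. -/
def quotientAction {E : Type*} [AddCommGroup E] [Module ℝ E] {Γ : Type*} [Group Γ]
    (ρ : Γ →* (E ≃ₗ[ℝ] E)) (W : Submodule ℝ E)
    (h : ∀ γ, W.map (ρ γ : E →ₗ[ℝ] E) = W) : Γ →* ((E ⧸ W) ≃ₗ[ℝ] (E ⧸ W)) where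
  toFun γ := Submodule.Quotient.equiv W W (ρ γ) (h γ)
  map_one' := by
    ext x
    induction x using Submodule.Quotient.induction_on
    simp
  map_mul' a b := by
    ext x
    induction x using Submodule.Quotient.induction_on
    simp

/-!
Let `L` be a `Γ`-invariant lattice in `V(ℚ)` and `K = closure C`, so that `C₊` is the cone generated
by the semigroup `A = K ∩ L`. Modulo `W` the cone `K` is salient, so a generic rational functional
in the interior of its dual cone takes each value on `A` only finitely often modulo `W`, and it
separates the classes of a given finite set from all the others. This yields an integral functional
`ξ ≥ 0` on `K` whose stabilizer in `Γ` acts trivially on `V ⧸ W`. Put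
`Π = {y ∈ C₊ | ∀ γ, ξ y ≤ ξ (γ y)}`.

On a cone generated by finitely many elements of `A`, the functionals `ξ ∘ γ` are given by tuples of
natural numbers, so by Dickson's lemma finitely many of them already attain their pointwise minimum.
Hence `Π` meets every orbit in `C₊`, has nonempty interior, and is a finite union of pieces cut out
by finitely many inequalities from translates of a cone in `C₊` lifting the given cone in `V ⧸ W`;
this makes it rational polyhedral. A point interior to `Π` and lying in `γ Π` is a zero of
`ξ ∘ γ⁻¹ - ξ`, and a functional which is nonnegative on `Π` and vanishes at an interior point is
zero; so `γ` fixes `ξ`, acts trivially on `V ⧸ W`, and maps `Π` to itself because `W ⊆ Π`.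
-/

open PointedCone

section DoubleDescription

variable {𝕜 E F G : Type*} [Field 𝕜] [LinearOrder 𝕜] [IsStrictOrderedRing 𝕜] [AddCommGroup E]
  [Module 𝕜 E] [AddCommGroup F] [Module 𝕜 F] [AddCommGroup G] [Module 𝕜 G]

theorem nonneg_of_mem_hull {s : Set E} {φ : Module.Dual 𝕜 E} (h : ∀ a ∈ s, 0 ≤ φ a) {x : E}
    (hx : x ∈ hull 𝕜 s) : 0 ≤ φ x :=
  (Submodule.span_le (p := (positive 𝕜 𝕜).comap φ)).2 h hx

theorem eq_zero_or_pos_of_mem_hull {s : Set E} {φ : Module.Dual 𝕜 E} (h : ∀ a ∈ s, 0 < φ a)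
    {x : E} (hx : x ∈ hull 𝕜 s) : x = 0 ∨ 0 < φ x := by
  induction hx using Submodule.span_induction with
  | mem a ha => exact Or.inr (h a ha)
  | zero => exact Or.inl rfl
  | add x y _ _ hx hy =>
    rcases hx with rfl | hx
    · simpa using hy
    · rcases hy with rfl | hy
      · simpa using Or.inr hx
      · exact Or.inr (by simpa using add_pos hx hy)
  | smul c x _ hx =>
    rcases hx with rfl | hx
    · simp
    · rcases c.2.eq_or_lt with hc | hc
      · exact Or.inl (by rw [← Nonneg.coe_smul, ← hc, zero_smul])
      · exact Or.inr (by rw [← Nonneg.coe_smul, map_smul]; exact smul_pos hc hx)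

theorem apply_apply_mem_of_mem_hull {s : Set E} {t : Set F} {K : PointedCone 𝕜 G}
    (B : E →ₗ[𝕜] F →ₗ[𝕜] G) (h : ∀ a ∈ s, ∀ b ∈ t, B a b ∈ K) {x : E} (hx : x ∈ hull 𝕜 s) {y : F}
    (hy : y ∈ hull 𝕜 t) : B x y ∈ K :=
  have hs : ∀ a ∈ s, B a y ∈ K := fun a ha =>
    (Submodule.span_le (p := K.comap (B a))).2 (h a ha) hy
  (Submodule.span_le (p := K.comap (B.flip y))).2 hs hx

theorem mem_hull_insert_iff {s : Set E} {v x : E} :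
    x ∈ hull 𝕜 (insert v s) ↔ ∃ t : 𝕜, 0 ≤ t ∧ x - t • v ∈ hull 𝕜 s := by
  rw [hull, Submodule.mem_span_insert]
  constructor
  · rintro ⟨a, z, hz, rfl⟩
    exact ⟨a, a.2, by simpa [← Nonneg.coe_smul] using hz⟩
  · rintro ⟨t, ht, h⟩
    exact ⟨⟨t, ht⟩, _, h, by simp [← Nonneg.coe_smul]⟩

/-- The generators produced by one step of the double description method, which cuts the cone
generated by `s` with the half-space `0 ≤ φ`: the generators in the half-space, and the points where
the segments joining them to the other generators meet the hyperplane `φ = 0`, up to scaling.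
Applied to a set of functionals and evaluation at a vector, this is a step of Fourier–Motzkin
elimination. -/
def halfspaceGenerators (s : Set E) (φ : Module.Dual 𝕜 E) : Set E :=
  {a ∈ s | 0 ≤ φ a} ∪
    Set.image2 (fun a b => φ a • b - φ b • a) {a ∈ s | 0 ≤ φ a} {b ∈ s | φ b < 0}

omit [IsStrictOrderedRing 𝕜] in
theorem finite_halfspaceGenerators {s : Set E} (hs : s.Finite) (φ : Module.Dual 𝕜 E) :
    (halfspaceGenerators s φ).Finite :=
  (hs.sep _).union ((hs.sep _).image2 _ (hs.sep _))

theorem halfspaceGenerators_subset (s : Set E) (φ : Module.Dual 𝕜 E) :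
    halfspaceGenerators s φ ⊆ (hull 𝕜 s ⊓ dual .id {φ} : PointedCone 𝕜 E) := by
  rintro _ (⟨ha, h⟩ | ⟨a, ⟨ha, hφa⟩, b, ⟨hb, hφb⟩, rfl⟩)
  · exact ⟨subset_hull ha, by simpa using h⟩
  · refine ⟨?_, by simp [mul_comm]⟩
    simp only [sub_eq_add_neg, ← neg_smul]
    exact add_mem (smul_mem _ hφa (subset_hull hb))
      (smul_mem _ (neg_nonneg.2 hφb.le) (subset_hull ha))

theorem hull_halfspaceGenerators (s : Set E) (φ : Module.Dual 𝕜 E) :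
    hull 𝕜 (halfspaceGenerators s φ) = hull 𝕜 s ⊓ dual .id {φ} := by
  refine le_antisymm (Submodule.span_le.2 (halfspaceGenerators_subset s φ)) ?_
  rintro x ⟨hx, hφx⟩
  replace hφx : 0 ≤ φ x := hφx rfl
  have hs : s = {a ∈ s | 0 ≤ φ a} ∪ {b ∈ s | φ b < 0} := by
    ext a
    simp only [Set.mem_union, Set.mem_ofPred_eq, ← and_or_left, le_or_gt, and_true]
  rw [hs, hull, Submodule.span_union] at hx
  obtain ⟨u, hu, v, hv, rfl⟩ := Submodule.mem_sup.1 hx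
  have hut : u ∈ hull 𝕜 (halfspaceGenerators s φ) :=
    Submodule.span_mono Set.subset_union_left hu
  have huv : φ u • v - φ v • u ∈ hull 𝕜 (halfspaceGenerators s φ) :=
    apply_apply_mem_of_mem_hull (K := hull 𝕜 (halfspaceGenerators s φ))
      (φ.smulRight (LinearMap.id (M := E)) - (φ.smulRight (LinearMap.id (M := E))).flip)
      (fun a ha b hb => subset_hull (Or.inr ⟨a, ha, b, hb, rfl⟩)) hu hv
  rcases eq_zero_or_pos_of_mem_hull (φ := -φ) (fun b hb => neg_pos.2 hb.2) hv with rfl | hφv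
  · simpa using hut
  · rw [LinearMap.neg_apply, neg_pos] at hφv
    rw [map_add] at hφx
    have hφu : 0 < φ u := by linarith
    rw [← smul_mem_iff _ hφu]
    have hcomb : φ u • (u + v) = (φ u + φ v) • u + (φ u • v - φ v • u) := by module
    rw [hcomb]
    exact add_mem (smul_mem _ hφx hut) huv

theorem mem_dual_halfspaceGenerators_iff {T : Set (Module.Dual 𝕜 E)} (hT : T.Finite) {v x : E} :
    x ∈ dual .id (halfspaceGenerators T (Module.Dual.eval 𝕜 E v)) ↔
      ∃ t : 𝕜, 0 ≤ t ∧ x - t • v ∈ dual .id T := by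
  constructor
  · intro h
    have hnonneg : ∀ a ∈ T, 0 ≤ a v → 0 ≤ a x := fun a ha hav => h (Or.inl ⟨ha, hav⟩)
    have hmixed : ∀ a ∈ T, 0 ≤ a v → ∀ b ∈ T, b v < 0 → 0 ≤ a v * b x - b v * a x :=
      fun a ha hav b hb hbv => h (Or.inr ⟨a, ⟨ha, hav⟩, b, ⟨hb, hbv⟩, rfl⟩)
    obtain ⟨t, ht, hmax⟩ := Set.exists_max_image
      (insert 0 ((fun b : Module.Dual 𝕜 E => b x / b v) '' {b ∈ T | b v < 0})) id
      (((hT.sep _).image _).insert 0) (Set.insert_nonempty _ _)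
    refine ⟨t, hmax 0 (Set.mem_insert _ _), fun a ha => ?_⟩
    simp only [LinearMap.id_apply, map_sub, map_smul, smul_eq_mul]
    rcases lt_or_ge (a v) 0 with hav | hav
    · have hat : a x / a v ≤ t := hmax _ (Or.inr ⟨a, ⟨ha, hav⟩, rfl⟩)
      rw [div_le_iff_of_neg hav] at hat
      linarith
    · rcases ht with rfl | ⟨b, ⟨hb, hbv⟩, rfl⟩
      · simpa using hnonneg a ha hav
      · rw [sub_nonneg, div_mul_eq_mul_div, div_le_iff_of_neg hbv]
        linarith [hmixed a ha hav b hb hbv]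
  · rintro ⟨t, ht, h⟩ a ha
    have hle : ∀ a ∈ T, t * a v ≤ a x := fun a ha => by simpa using h ha
    rcases ha with ⟨ha, hav⟩ | ⟨a, ⟨ha, hav⟩, b, ⟨hb, hbv⟩, rfl⟩
    · exact (mul_nonneg ht hav).trans (hle a ha)
    · have hab := mul_le_mul_of_nonneg_left (hle b hb) hav
      have hba := mul_le_mul_of_nonpos_left (hle a ha) hbv.le
      simp only [Module.Dual.eval_apply, LinearMap.id_apply, LinearMap.sub_apply,
        LinearMap.smul_apply, smul_eq_mul] at hab hba ⊢
      linarith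

theorem dualFG_bot [FiniteDimensional 𝕜 E] : (⊥ : PointedCone 𝕜 E).DualFG .id := by
  let b := Module.finBasis 𝕜 E
  rw [show (⊥ : PointedCone 𝕜 E) = dual .id (Set.range b.coord ∪ -Set.range b.coord) from ?_]
  · exact DualFG.dual_of_finite _ ((Set.finite_range _).union (Set.finite_range _).neg)
  refine le_antisymm bot_le fun x hx => (Submodule.mem_bot _).2 (b.ext_elem fun i => ?_)
  have hpos : 0 ≤ b.repr x i := hx (Or.inl ⟨i, rfl⟩)
  have hneg : 0 ≤ -b.repr x i := hx (x := -b.coord i) (Or.inr ⟨i, by simp⟩)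
  rw [map_zero, Finsupp.zero_apply]
  exact le_antisymm (neg_nonneg.1 hneg) hpos

theorem dualFG_hull [FiniteDimensional 𝕜 E] (s : Finset E) :
    (hull 𝕜 (s : Set E)).DualFG .id := by
  classical
  induction s using Finset.induction_on with
  | empty => simpa [hull] using dualFG_bot
  | insert v s _ ih =>
    obtain ⟨T, hT⟩ := ih
    have hstep : hull 𝕜 (↑(insert v s) : Set E) =
        dual .id (halfspaceGenerators (T : Set (Module.Dual 𝕜 E)) (Module.Dual.eval 𝕜 E v)) := by
      ext x
      rw [Finset.coe_insert, mem_hull_insert_iff, mem_dual_halfspaceGenerators_iff T.finite_toSet,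
        hT]
    rw [hstep]
    exact DualFG.dual_of_finite _ (finite_halfspaceGenerators T.finite_toSet _)

end DoubleDescription

theorem isClosed_hull_finset {E : Type*} [NormedAddCommGroup E] [NormedSpace ℝ E]
    [FiniteDimensional ℝ E] (s : Finset E) : IsClosed (hull ℝ (s : Set E) : Set E) := by
  obtain ⟨T, hT⟩ := dualFG_hull (𝕜 := ℝ) s
  have hinter : (hull ℝ (s : Set E) : Set E) = ⋂ a ∈ T, {x | 0 ≤ a x} := by
    ext x
    simp [← hT]
  rw [hinter]
  exact isClosed_biInter fun a _ =>
    isClosed_le continuous_const a.continuous_of_finiteDimensional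

section RatPoints

variable {E : Type*} [AddCommGroup E] {L : Submodule ℤ E}

theorem subset_ratPoints : (L : Set E) ⊆ ratPoints L :=
  fun x hx => ⟨1, one_pos, by simpa using hx⟩

theorem ratPoints_subset_ratPoints {M : Submodule ℤ E} (h : (L : Set E) ⊆ ratPoints M) :
    ratPoints L ⊆ ratPoints M := by
  rintro x ⟨n, hn, hx⟩
  obtain ⟨m, hm, hnx⟩ := h hx
  exact ⟨m * n, Nat.mul_pos hm hn, by rwa [mul_smul]⟩

end RatPoints

section RationalCones

variable {E F : Type*} [AddCommGroup E] [Module ℝ E] [AddCommGroup F] [Module ℝ F]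
  {L : Submodule ℤ E}

theorem nsmul_mem_iff_of_pointedCone {K : PointedCone ℝ E} {n : ℕ} (hn : 0 < n) {x : E} :
    n • x ∈ K ↔ x ∈ K := by
  rw [← Nat.cast_smul_eq_nsmul ℝ, smul_mem_iff K (Nat.cast_pos.2 hn)]

theorem mem_of_mem_ratPoints {S : Submodule ℝ E} (h : ∀ x ∈ L, x ∈ S) {x : E}
    (hx : x ∈ ratPoints L) : x ∈ S := by
  obtain ⟨n, hn, hnx⟩ := hx
  rw [← Submodule.smul_mem_iff S (Nat.cast_ne_zero (R := ℝ).2 hn.ne'), Nat.cast_smul_eq_nsmul]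
  exact h _ hnx

theorem span_inf_eq_of_subset_ratPoints {M : Submodule ℤ E} (h : (L : Set E) ⊆ ratPoints M) :
    Submodule.span ℝ ((L ⊓ M : Submodule ℤ E) : Set E) = Submodule.span ℝ (L : Set E) := by
  refine le_antisymm (Submodule.span_mono Set.inter_subset_left) <|
    Submodule.span_le.2 fun x hx => ?_
  obtain ⟨n, hn, hnx⟩ := h hx
  exact mem_of_mem_ratPoints (fun _ => Submodule.mem_span_of_mem)
    (L := L ⊓ M) ⟨n, hn, nsmul_mem hx n, hnx⟩

theorem IsDefinedOverRat.span_inter_eq {W : Submodule ℝ E} (hW : IsDefinedOverRat L W) :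
    Submodule.span ℝ ((W : Set E) ∩ L) = W := by
  refine le_antisymm (Submodule.span_le.2 Set.inter_subset_left) ?_
  nth_rw 1 [← hW]
  refine Submodule.span_le.2 fun x ⟨hx, n, hn, hnx⟩ => ?_
  exact mem_of_mem_ratPoints (fun _ => Submodule.mem_span_of_mem)
    (L := W.restrictScalars ℤ ⊓ L) ⟨n, hn, nsmul_mem hx n, hnx⟩

theorem IsDefinedOverRat.exists_basis {W : Submodule ℝ E} (hW : IsDefinedOverRat L W)
    (hL : Submodule.span ℝ (L : Set E) = ⊤) :
    ∃ (t : Set E) (b : Module.Basis t ℝ E) (s : Set t),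
      (∀ j, b j ∈ L) ∧ Submodule.span ℝ (b '' s) = W := by
  obtain ⟨s, hs, hsW, hli'⟩ := exists_linearIndependent ℝ ((W : Set E) ∩ L)
  rw [hW.span_inter_eq] at hsW
  have hli : LinearIndepOn ℝ id s := hli'
  have hsL : s ⊆ L := hs.trans Set.inter_subset_right
  refine ⟨_, .extendLe hli hsL hL.ge, Subtype.val ⁻¹' s, fun j => hli.extend_subset hsL ?_, ?_⟩
  · simp
  · rw [Module.Basis.coe_extendLe, Subtype.image_preimage_coe,
      Set.inter_eq_right.2 (hli.subset_extend hsL), hsW]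

/-- The functionals which are integral on `L`: the dual lattice, when `L` is a lattice. -/
def dualLattice (L : Submodule ℤ E) : Submodule ℤ (Module.Dual ℝ E) where
  carrier := {φ | ∀ x ∈ L, ∃ k : ℤ, φ x = k}
  zero_mem' x _ := ⟨0, by simp⟩
  add_mem' {φ ψ} hφ hψ x hx := by
    obtain ⟨k, hk⟩ := hφ x hx
    obtain ⟨l, hl⟩ := hψ x hx
    exact ⟨k + l, by simp [hk, hl]⟩
  smul_mem' m φ hφ x hx := by
    obtain ⟨k, hk⟩ := hφ x hx
    exact ⟨m * k, by simp [hk]⟩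

theorem comp_mem_dualLattice {f : E →ₗ[ℝ] E} (hf : ∀ x ∈ L, f x ∈ L) {φ : Module.Dual ℝ E}
    (hφ : φ ∈ dualLattice L) : φ ∘ₗ f ∈ dualLattice L :=
  fun x hx => hφ (f x) (hf x hx)

theorem exists_nat_of_mem_dualLattice {φ : Module.Dual ℝ E} (hφ : φ ∈ dualLattice L) {x : E}
    (hx : x ∈ L) (h : 0 ≤ φ x) : ∃ n : ℕ, φ x = n := by
  obtain ⟨k, hk⟩ := hφ x hx
  rw [hk, Int.cast_nonneg_iff] at h
  lift k to ℕ using h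
  exact ⟨k, by simpa using hk⟩

theorem halfspaceGenerators_subset_lattice {s : Set E} (hs : s ⊆ L) {φ : Module.Dual ℝ E}
    (hφ : φ ∈ dualLattice L) : halfspaceGenerators s φ ⊆ L := by
  rintro _ (⟨ha, -⟩ | ⟨a, ⟨ha, -⟩, b, ⟨hb, -⟩, rfl⟩)
  · exact hs ha
  · obtain ⟨k, hk⟩ := hφ a (hs ha)
    obtain ⟨l, hl⟩ := hφ b (hs hb)
    simp only [hk, hl, Int.cast_smul_eq_zsmul]
    exact sub_mem (L.smul_mem _ (hs hb)) (L.smul_mem _ (hs ha))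

namespace IsRationalPolyhedralCone

theorem mono {M : Submodule ℤ E} (h : ratPoints L ⊆ ratPoints M) {P : Set E}
    (hP : IsRationalPolyhedralCone L P) : IsRationalPolyhedralCone M P :=
  let ⟨s, hs, hP⟩ := hP
  ⟨s, hs.trans h, hP⟩

theorem of_finite {s : Set E} (hs : s.Finite) (hsL : s ⊆ ratPoints L) :
    IsRationalPolyhedralCone L (hull ℝ s : Set E) :=
  ⟨hs.toFinset, by simpa using hsL, by simp⟩

theorem exists_generators {K : PointedCone ℝ E} (hK : IsRationalPolyhedralCone L (K : Set E)) :
    ∃ s : Set E, s.Finite ∧ s ⊆ L ∧ hull ℝ s = K := by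
  obtain ⟨s, hsL, hs⟩ := hK
  obtain rfl := SetLike.coe_injective hs
  choose! n hn hnL using fun a (ha : a ∈ (s : Set E)) => hsL ha
  refine ⟨(fun a => n a • a) '' s, s.finite_toSet.image _, Set.image_subset_iff.2 hnL,
    le_antisymm (Submodule.span_le.2 ?_) (Submodule.span_le.2 fun a ha => ?_)⟩
  · rintro _ ⟨a, ha, rfl⟩
    exact nsmul_mem (subset_hull ha) _
  · exact (nsmul_mem_iff_of_pointedCone (hn a ha)).1 (subset_hull ⟨a, ha, rfl⟩)

theorem isClosed {E : Type*} [NormedAddCommGroup E] [NormedSpace ℝ E] [FiniteDimensional ℝ E]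
    {L : Submodule ℤ E} {P : Set E} (hP : IsRationalPolyhedralCone L P) : IsClosed P := by
  obtain ⟨s, -, rfl⟩ := hP
  exact isClosed_hull_finset s

protected theorem bot : IsRationalPolyhedralCone L ((⊥ : PointedCone ℝ E) : Set E) :=
  ⟨∅, by simp, by simp [hull]⟩

protected theorem sup {K₁ K₂ : PointedCone ℝ E} (h₁ : IsRationalPolyhedralCone L (K₁ : Set E))
    (h₂ : IsRationalPolyhedralCone L (K₂ : Set E)) :
    IsRationalPolyhedralCone L ((K₁ ⊔ K₂ : PointedCone ℝ E) : Set E) := by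
  obtain ⟨s₁, hs₁, hL₁, rfl⟩ := h₁.exists_generators
  obtain ⟨s₂, hs₂, hL₂, rfl⟩ := h₂.exists_generators
  rw [hull, hull, ← Submodule.span_union]
  exact of_finite (hs₁.union hs₂) ((Set.union_subset hL₁ hL₂).trans subset_ratPoints)

theorem finset_sup {ι : Type*} (s : Finset ι) {K : ι → PointedCone ℝ E}
    (h : ∀ i ∈ s, IsRationalPolyhedralCone L (K i : Set E)) :
    IsRationalPolyhedralCone L ((s.sup K : PointedCone ℝ E) : Set E) :=
  Finset.sup_induction (p := fun K : PointedCone ℝ E => IsRationalPolyhedralCone L (K : Set E))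
    .bot (fun _ h₁ _ h₂ => h₁.sup h₂) h

protected theorem map {K : PointedCone ℝ E} (hK : IsRationalPolyhedralCone L (K : Set E))
    {f : E →ₗ[ℝ] F} {M : Submodule ℤ F} (hf : ∀ x ∈ L, f x ∈ M) :
    IsRationalPolyhedralCone M (K.map f : Set F) := by
  obtain ⟨s, hs, hsL, rfl⟩ := hK.exists_generators
  rw [PointedCone.map, hull, Submodule.map_span]
  exact of_finite (hs.image _)
    ((Set.image_subset_iff.2 fun a ha => hf a (hsL ha)).trans subset_ratPoints)

theorem inf_dual {K : PointedCone ℝ E} (hK : IsRationalPolyhedralCone L (K : Set E))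
    {T : Set (Module.Dual ℝ E)} (hT : T.Finite) (hTL : T ⊆ dualLattice L) :
    IsRationalPolyhedralCone L ((K ⊓ dual .id T : PointedCone ℝ E) : Set E) := by
  induction T, hT using Set.Finite.induction_on with
  | empty => simpa using hK
  | @insert φ T _ _ ih =>
    obtain ⟨hφ, hTL⟩ := Set.insert_subset_iff.1 hTL
    obtain ⟨s, hs, hsL, hsT⟩ := (ih hTL).exists_generators
    rw [dual_insert, inf_comm (dual _ _), ← inf_assoc, ← hsT, ← hull_halfspaceGenerators]
    exact of_finite (finite_halfspaceGenerators hs φ)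
      ((halfspaceGenerators_subset_lattice hsL hφ).trans subset_ratPoints)

end IsRationalPolyhedralCone

theorem hull_union_neg (s : Set E) : hull ℝ (s ∪ -s) = Submodule.span ℝ s := by
  refine le_antisymm (Submodule.span_le.2 ?_) ?_
  · exact Set.union_subset Submodule.subset_span
      (fun x hx => neg_mem_iff (S := Submodule ℝ E).1 (Submodule.subset_span hx))
  · have hlineal : Submodule.span ℝ s ≤ (hull ℝ (s ∪ -s)).lineal := Submodule.span_le.2 fun a ha =>
      mem_lineal.2 ⟨subset_hull (Or.inl ha), subset_hull (Or.inr (by simpa using ha))⟩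
    exact fun x hx => (hlineal hx).1

theorem IsDefinedOverRat.isRationalPolyhedralCone [FiniteDimensional ℝ E] {W : Submodule ℝ E}
    (hW : IsDefinedOverRat L W) : IsRationalPolyhedralCone L (W : Set E) := by
  obtain ⟨t, ht, htW⟩ := (Submodule.fg_span_iff_fg_span_finset_subset
    ((W : Set E) ∩ ratPoints L)).1 (IsNoetherian.noetherian (Submodule.span ℝ _))
  have hWt : Submodule.span ℝ (t : Set E) = W := htW.symm.trans hW
  have hcone : (W : Set E) = (hull ℝ ((t : Set E) ∪ -t) : Set E) := by
    rw [hull_union_neg, hWt, coe_ofSubmodule]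
  rw [hcone]
  refine .of_finite (t.finite_toSet.union t.finite_toSet.neg)
    (Set.union_subset (fun a ha => (ht ha).2) fun a ha => ?_)
  obtain ⟨-, n, hn, hna⟩ := ht ha
  exact ⟨n, hn, by simpa using hna⟩

end RationalCones

section Lattices

variable {E : Type*} [NormedAddCommGroup E] [NormedSpace ℝ E] [FiniteDimensional ℝ E]

theorem exists_pos_forall_nsmul_mem {N L : Submodule ℤ E} [DiscreteTopology L] [IsZLattice ℝ L]
    (hNL : N ≤ L) (hN : Submodule.span ℝ (N : Set E) = ⊤) :
    ∃ d : ℕ, 0 < d ∧ ∀ x ∈ L, d • x ∈ N := by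
  have : DiscreteTopology N := DiscreteTopology.of_subset ‹DiscreteTopology L› hNL
  have : IsZLattice ℝ N := ⟨hN⟩
  have : Module.Free ℤ L := ZLattice.module_free ℝ L
  have : Module.Finite ℤ L := ZLattice.module_finite ℝ L
  have hrank : Module.finrank ℤ (N.submoduleOf L) = Module.finrank ℤ L := by
    rw [(Submodule.submoduleOfEquivOfLe hNL).finrank_eq, ZLattice.rank ℝ N, ZLattice.rank ℝ L]
  have : Finite (L ⧸ N.submoduleOf L) := Submodule.finiteQuotientOfFreeOfRankEq _ hrank
  refine ⟨Nat.card (L ⧸ N.submoduleOf L), Nat.card_pos, fun x hx => ?_⟩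
  have hcard : Nat.card (L ⧸ N.submoduleOf L) • (N.submoduleOf L).mkQ ⟨x, hx⟩ = 0 :=
    card_nsmul_eq_zero'
  rw [← map_nsmul] at hcard
  exact (Submodule.Quotient.mk_eq_zero (N.submoduleOf L)).1 hcard

theorem ratPoints_eq_ratPoints {L M : Submodule ℤ E} [DiscreteTopology L] [IsZLattice ℝ L]
    [DiscreteTopology M] [IsZLattice ℝ M] (h : (L : Set E) ⊆ ratPoints M) :
    ratPoints M = ratPoints L := by
  refine (ratPoints_subset_ratPoints fun x hx => ?_).antisymm (ratPoints_subset_ratPoints h)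
  have hspan : Submodule.span ℝ ((L ⊓ M : Submodule ℤ E) : Set E) = ⊤ := by
    rw [span_inf_eq_of_subset_ratPoints h, IsZLattice.span_top]
  obtain ⟨d, hd, hdL⟩ := exists_pos_forall_nsmul_mem inf_le_right hspan
  exact ⟨d, hd, (hdL x hx).1⟩

theorem dense_ratPoints {L : Submodule ℤ E} (hL : Submodule.span ℝ (L : Set E) = ⊤) :
    Dense (ratPoints L) := by
  let b := Module.Basis.ofSpan hL.ge
  have hb : ∀ i, b i ∈ L := fun i => Module.Basis.ofSpan_subset hL.ge ⟨i, rfl⟩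
  have : Fintype _ := FiniteDimensional.fintypeBasisIndex b
  have hdense : DenseRange (b.equivFun.symm ∘ Pi.map fun _ => ((↑) : ℚ → ℝ)) :=
    b.equivFun.symm.surjective.denseRange.comp (DenseRange.piMap fun _ => Rat.denseRange_cast)
      (LinearMap.continuous_of_finiteDimensional b.equivFun.symm.toLinearMap)
  refine hdense.mono ?_
  rintro _ ⟨q, rfl⟩
  refine ⟨∏ i, (q i).den, Finset.prod_pos fun i _ => (q i).den_pos, ?_⟩
  rw [Function.comp_apply, Module.Basis.equivFun_symm_apply, Finset.smul_sum]
  refine sum_mem fun i _ => ?_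
  obtain ⟨m, hm⟩ := Finset.dvd_prod_of_mem (fun i => (q i).den) (Finset.mem_univ i)
  have hint : (∏ i, (q i).den) • (q i : ℝ) • b i = ((m : ℤ) * (q i).num) • b i := by
    rw [hm, ← Int.cast_smul_eq_zsmul ℝ, ← Nat.cast_smul_eq_nsmul ℝ, smul_smul]
    have hden : ((q i).den : ℝ) * q i = (q i).num := by exact_mod_cast Rat.den_mul_eq_num (q i)
    push_cast
    rw [← hden]
    ring_nf
  rw [Pi.map_apply, hint]
  exact L.smul_mem _ (hb i)

end Lattices

universe u

theorem exists_linearMap_euclideanSpace_ker_eq {E : Type u} [NormedAddCommGroup E]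
    [NormedSpace ℝ E] [FiniteDimensional ℝ E] {L : Submodule ℤ E} [DiscreteTopology L]
    [IsZLattice ℝ L] {W : Submodule ℝ E} (hW : IsDefinedOverRat L W) :
    ∃ (ι : Type u) (_ : Fintype ι) (ζ : E →ₗ[ℝ] EuclideanSpace ℝ ι),
      LinearMap.range ζ = ⊤ ∧ LinearMap.ker ζ = W ∧
        ∀ x ∈ L, ζ x ∈ Submodule.span ℤ (Set.range (EuclideanSpace.basisFun ι ℝ).toBasis) := by
  obtain ⟨t, b, s, hbL, rfl⟩ := hW.exists_basis (L := L) IsZLattice.span_top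
  have : Fintype t := FiniteDimensional.fintypeBasisIndex b
  obtain ⟨d, hd, hdL⟩ := exists_pos_forall_nsmul_mem
    (Submodule.span_le.2 (Set.range_subset_iff.2 hbL))
    (by rw [Submodule.span_span_of_tower, b.span_eq])
  let ζ : E →ₗ[ℝ] EuclideanSpace ℝ {j // j ∉ s} :=
    (WithLp.linearEquiv 2 ℝ _).symm.toLinearMap ∘ₗ
      LinearMap.funLeft ℝ ℝ Subtype.val ∘ₗ b.equivFun.toLinearMap
  have hd' : (d : ℝ) ≠ 0 := Nat.cast_ne_zero.2 hd.ne'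
  classical
  refine ⟨{j // j ∉ s}, inferInstance, (d : ℝ) • ζ, ?_, ?_, fun x hx => ?_⟩
  · rw [LinearMap.range_smul _ _ hd', LinearMap.range_eq_top]
    exact (WithLp.linearEquiv 2 ℝ _).symm.surjective.comp
      ((LinearMap.funLeft_surjective_of_injective ℝ ℝ _ Subtype.val_injective).comp
        b.equivFun.surjective)
  · rw [LinearMap.ker_smul _ _ hd']
    ext x
    have hζx : ζ x = 0 ↔ ∀ j ∉ s, b.repr x j = 0 := by
      simp [ζ, funext_iff]
    rw [LinearMap.mem_ker, hζx, Module.Basis.mem_span_image]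
    exact ⟨fun h j hj => by_contra fun hjs => Finsupp.mem_support_iff.1 hj (h j hjs),
      fun h j hj => Finsupp.notMem_support_iff.1 fun hjs => hj (h hjs)⟩
  · rw [Module.Basis.mem_span_iff_repr_mem]
    intro j
    obtain ⟨k, hk⟩ := (b.mem_span_iff_repr_mem ℤ _).1 (hdL x hx) j
    exact ⟨k, by simpa [ζ] using hk⟩

theorem nonempty_interior_iff_span_eq_top {E : Type*} [NormedAddCommGroup E] [NormedSpace ℝ E]
    [FiniteDimensional ℝ E] (K : PointedCone ℝ E) :
    (interior (K : Set E)).Nonempty ↔ Submodule.span ℝ (K : Set E) = ⊤ := by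
  rw [K.convex.interior_nonempty_iff_affineSpan_eq_top,
    ← Set.insert_eq_of_mem (SetLike.mem_coe.2 K.zero_mem), ← AffineSubspace.coe_eq_univ_iff,
    affineSpan_insert_zero, ← Submodule.coe_eq_univ, Submodule.span_insert_zero]

theorem dense_compl_of_ne_top {E : Type*} [NormedAddCommGroup E] [NormedSpace ℝ E]
    {S : Submodule ℝ E} (hS : S ≠ ⊤) : Dense (S : Set E)ᶜ := by
  rw [← interior_eq_empty_iff_dense_compl, ← Set.not_nonempty_iff_eq_empty]
  exact fun hne => hS (Submodule.eq_top_of_nonempty_interior' S hne)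

section SalientCones

open scoped RealInnerProductSpace

variable {F : Type*} [NormedAddCommGroup F] [InnerProductSpace ℝ F]

theorem dense_setOf_inner_ne_zero {δ : F} (hδ : δ ≠ 0) : Dense {q : F | ⟪δ, q⟫ ≠ 0} := by
  have hker : LinearMap.ker (innerₛₗ ℝ δ) ≠ ⊤ := fun h =>
    hδ (inner_self_eq_zero.1 (LinearMap.mem_ker.1 (h.ge (Submodule.mem_top (x := δ)))))
  convert! dense_compl_of_ne_top hker using 1

variable [FiniteDimensional ℝ F]

theorem exists_mem_forall_inner_ne_zero {D U : Set F} (hD : Dense D) (hU : IsOpen U)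
    (hUne : U.Nonempty) {Δ : Set F} (hΔ : Δ.Finite) (h0 : 0 ∉ Δ) :
    ∃ q ∈ D, q ∈ U ∧ ∀ δ ∈ Δ, ⟪δ, q⟫ ≠ 0 := by
  have hopen : ∀ δ ∈ Δ, IsOpen {q : F | ⟪δ, q⟫ ≠ 0} := fun δ _ =>
    isOpen_ne_fun (by fun_prop) (by fun_prop)
  have hdense : Dense (⋂ δ ∈ Δ, {q : F | ⟪δ, q⟫ ≠ 0}) :=
    dense_biInter_of_isOpen hopen hΔ.countable fun δ hδ =>
      dense_setOf_inner_ne_zero (ne_of_mem_of_not_mem hδ h0)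
  obtain ⟨q, ⟨hqΔ, hqD⟩, hqU⟩ :=
    (hdense.inter_of_isOpen_left hD (hΔ.isOpen_biInter hopen)).exists_mem_open hU hUne
  exact ⟨q, hqD, hqU, Set.mem_iInter₂.1 hqΔ⟩

theorem mul_norm_le_inner_of_closedBall_subset {K : Set F} {c : F} {r : ℝ} (hr : 0 ≤ r)
    (hc : Metric.closedBall c r ⊆ ProperCone.innerDual K) {x : F} (hx : x ∈ K) :
    r * ‖x‖ ≤ ⟪x, c⟫ := by
  rcases eq_or_ne x 0 with rfl | hx0
  · simp
  have hmem : c - (r / ‖x‖) • x ∈ Metric.closedBall c r := by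
    rw [mem_closedBall_iff_norm, sub_sub_cancel_left, norm_neg, norm_smul, norm_div, norm_norm,
      div_mul_cancel₀ _ (norm_ne_zero_iff.2 hx0), Real.norm_of_nonneg hr]
  have hinner : 0 ≤ ⟪x, c - (r / ‖x‖) • x⟫ := ProperCone.mem_innerDual.1 (hc hmem) hx
  rw [inner_sub_right, inner_smul_right, real_inner_self_eq_norm_sq, sq, ← mul_assoc,
    div_mul_cancel₀ _ (norm_ne_zero_iff.2 hx0)] at hinner
  linarith

theorem isBounded_setOf_inner_le {K : Set F} {c : F} {r : ℝ} (hr : 0 < r)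
    (hc : Metric.closedBall c r ⊆ ProperCone.innerDual K) (R : ℝ) :
    Bornology.IsBounded {x ∈ K | ∃ q ∈ Metric.ball c (r / 2), ⟪x, q⟫ ≤ R} := by
  refine isBounded_iff_forall_norm_le.2 ⟨R / (r / 2), fun x ⟨hx, q, hq, hxq⟩ => ?_⟩
  have hqr : Metric.closedBall q (r / 2) ⊆ ProperCone.innerDual K :=
    (Metric.closedBall_subset_closedBall' (by linarith [Metric.mem_ball.1 hq])).trans hc
  rw [le_div_iff₀' (half_pos hr)]
  exact (mul_norm_le_inner_of_closedBall_subset (half_pos hr).le hqr hx).trans hxq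

theorem nonempty_interior_innerDual {K : ProperCone ℝ F} (hK : ∀ x ∈ K, -x ∈ K → x = 0) :
    (interior (ProperCone.innerDual (K : Set F) : Set F)).Nonempty := by
  refine (nonempty_interior_iff_span_eq_top
    (ProperCone.innerDual (K : Set F)).toPointedCone).2 ?_
  rw [← Submodule.orthogonal_eq_bot_iff, Submodule.eq_bot_iff]
  intro f hf
  have horth : ∀ y ∈ ProperCone.innerDual (K : Set F), ⟪y, f⟫ = 0 := fun y hy =>
    Submodule.inner_right_of_mem_orthogonal (Submodule.subset_span hy) hf
  have hdual : ∀ x, (∀ y ∈ ProperCone.innerDual (K : Set F), ⟪y, x⟫ = 0) → x ∈ K := fun x hx => by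
    rw [← ProperCone.innerDual_innerDual K]
    exact ProperCone.mem_innerDual.2 fun y hy => (hx y hy).ge
  exact hK f (hdual f horth) (hdual (-f) fun y hy => by rw [inner_neg_right, horth y hy, neg_zero])

theorem exists_mem_innerDual_forall_inner_eq_imp_eq {K : ProperCone ℝ F}
    (hK : ∀ x ∈ K, -x ∈ K → x = 0) (M : Submodule ℤ F) [DiscreteTopology M] {D : Set F}
    (hD : Dense D) {s : Set F} (hs : s.Finite) :
    ∃ q ∈ D, q ∈ ProperCone.innerDual (K : Set F) ∧
      ∀ a ∈ s, ∀ x ∈ K, x ∈ M → ⟪x, q⟫ = ⟪a, q⟫ → x = a := by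
  obtain ⟨c, hc⟩ := nonempty_interior_innerDual hK
  obtain ⟨r, hr, hball⟩ :=
    Metric.nhds_basis_closedBall.mem_iff.1 (mem_interior_iff_mem_nhds.1 hc)
  obtain ⟨B, hB⟩ := hs.isBounded.exists_norm_le
  -- The bound is uniform in `q ∈ ball c (r / 2)`, so a single finite set of points of `M` contains
  -- every competitor, and `q` only has to avoid finitely many hyperplanes.
  have hbound : ∀ a ∈ s, ∀ q ∈ Metric.ball c (r / 2), ⟪a, q⟫ ≤ B * (‖c‖ + r / 2) :=
    fun a ha q hq => (real_inner_le_norm a q).trans <|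
      mul_le_mul (hB a ha) (norm_lt_of_mem_ball hq).le (norm_nonneg q)
        ((norm_nonneg a).trans (hB a ha))
  have hfin := Metric.finite_isBounded_inter_isClosed (s := (M : Set F))
    DiscreteTopology.isDiscrete (isBounded_setOf_inner_le hr hball (B * (‖c‖ + r / 2)))
    (AddSubgroup.isClosed_of_discrete (H := M.toAddSubgroup))
  obtain ⟨q, hqD, hqball, hqne⟩ := exists_mem_forall_inner_ne_zero hD
    (Metric.isOpen_ball (x := c) (ε := r / 2)) ⟨c, Metric.mem_ball_self (half_pos hr)⟩
    ((hfin.image2 (· - ·) hs).sdiff (t := {0})) (by simp)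
  refine ⟨q, hqD, hball (Metric.ball_subset_closedBall
    (Metric.ball_subset_ball (half_le_self hr.le) hqball)), fun a ha x hx hxM hxa => ?_⟩
  by_contra hne
  refine hqne (x - a) ⟨⟨x, ⟨⟨hx, q, hqball, hxa.trans_le (hbound a ha q hqball)⟩, hxM⟩, a, ha, rfl⟩,
    sub_ne_zero.2 hne⟩ ?_
  rw [inner_sub_left, hxa, sub_self]

end SalientCones

section IntegralFunctionals

open scoped RealInnerProductSpace

theorem exists_int_inner_of_mem_span {ι : Type*} [Fintype ι] {x y : EuclideanSpace ℝ ι}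
    (hx : x ∈ Submodule.span ℤ (Set.range (EuclideanSpace.basisFun ι ℝ).toBasis))
    (hy : y ∈ Submodule.span ℤ (Set.range (EuclideanSpace.basisFun ι ℝ).toBasis)) :
    ∃ k : ℤ, ⟪x, y⟫ = k := by
  choose a ha using (Module.Basis.mem_span_iff_repr_mem ℤ _ x).1 hx
  choose b hb using (Module.Basis.mem_span_iff_repr_mem ℤ _ y).1 hy
  have ha' : ∀ i, x i = a i := fun i => by simpa using (ha i).symm
  have hb' : ∀ i, y i = b i := fun i => by simpa using (hb i).symm
  exact ⟨∑ i, b i * a i, by simp [PiLp.inner_apply, ha', hb']⟩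

theorem exists_mem_dualLattice_forall_apply_eq_imp_sub_mem {E : Type*} [NormedAddCommGroup E]
    [NormedSpace ℝ E] [FiniteDimensional ℝ E] {L : Submodule ℤ E} [DiscreteTopology L]
    [IsZLattice ℝ L] {K : ProperCone ℝ E} {W : Submodule ℝ E} (hWQ : IsDefinedOverRat L W)
    (hWK : ∀ x, x ∈ W ↔ x ∈ K ∧ -x ∈ K) {s : Set E} (hs : s.Finite) :
    ∃ ξ ∈ dualLattice L, (∀ x ∈ K, 0 ≤ ξ x) ∧
      ∀ a ∈ s, ∀ x ∈ K, x ∈ L → ξ x = ξ a → x - a ∈ W := by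
  obtain ⟨ι, _, ζ, hrange, rfl, hζL⟩ := exists_linearMap_euclideanSpace_ker_eq hWQ
  obtain ⟨σ, hσ⟩ := ζ.exists_rightInverse_of_surjective hrange
  replace hσ : ∀ y, ζ (σ y) = y := LinearMap.congr_fun hσ
  let K' : ProperCone ℝ (EuclideanSpace ℝ ι) := K.comap σ.toContinuousLinearMap
  have hsalient : ∀ y ∈ K', -y ∈ K' → y = 0 := fun y hy hy' => by
    rw [← hσ y, ← LinearMap.mem_ker, hWK]
    exact ⟨hy, by simpa using ProperCone.mem_comap.1 hy'⟩
  have hζK : ∀ x ∈ K, ζ x ∈ K' := fun x hx => by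
    have hker : σ (ζ x) - x ∈ LinearMap.ker ζ := by simp [hσ]
    have hσK : σ (ζ x) ∈ K := by simpa using add_mem hx ((hWK _).1 hker).1
    exact hσK
  let M := Submodule.span ℤ (Set.range (EuclideanSpace.basisFun ι ℝ).toBasis)
  have hM : Submodule.span ℝ (M : Set (EuclideanSpace ℝ ι)) = ⊤ := by
    rw [Submodule.span_span_of_tower, Module.Basis.span_eq]
  obtain ⟨q, ⟨n, hn, hnq⟩, hqK, hq⟩ := exists_mem_innerDual_forall_inner_eq_imp_eq hsalient M
    (dense_ratPoints hM) (hs.image ζ)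
  have hξ : ∀ x, (innerₛₗ ℝ (n • q) ∘ₗ ζ) x = n * ⟪ζ x, q⟫ := fun x => by
    rw [LinearMap.comp_apply, innerₛₗ_apply_apply, ← Nat.cast_smul_eq_nsmul ℝ,
      real_inner_smul_left, real_inner_comm]
  refine ⟨innerₛₗ ℝ (n • q) ∘ₗ ζ, fun x hx => exists_int_inner_of_mem_span hnq (hζL x hx),
    fun x hx => ?_, fun a ha x hx hxL hxa => ?_⟩
  · rw [hξ]
    exact mul_nonneg n.cast_nonneg (ProperCone.mem_innerDual.1 hqK (hζK x hx))
  · rw [hξ, hξ, mul_right_inj' (Nat.cast_ne_zero.2 hn.ne')] at hxa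
    rw [LinearMap.mem_ker, map_sub, sub_eq_zero]
    exact hq (ζ a) ⟨a, ha, rfl⟩ (ζ x) (hζK x hx) (hζL x hxL) hxa

end IntegralFunctionals

theorem exists_finset_forall_exists_le_of_nat {ι α : Type*} [Finite ι] (a : α → ι → ℕ) :
    ∃ F : Finset α, ∀ i, ∃ f ∈ F, a f ≤ a i := by
  have : Finite {m // Minimal (· ∈ Set.range a) m} :=
    WellQuasiOrderedLE.finite_of_isAntichain (setOfPred_minimal_antichain _)
  choose p hp using fun m : {m // Minimal (· ∈ Set.range a) m} => m.2.1
  refine ⟨(Set.finite_range p).toFinset, fun i => ?_⟩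
  obtain ⟨m, hm, hmin⟩ := exists_minimal_le_of_wellFoundedLT (· ∈ Set.range a) (a i) ⟨i, rfl⟩
  exact ⟨p ⟨m, hmin⟩, by simp, (hp ⟨m, hmin⟩).trans_le hm⟩

theorem exists_finset_forall_exists_forall_hull_le {E α : Type*} [AddCommGroup E] [Module ℝ E]
    {s : Set E} (hs : s.Finite) {φ : α → Module.Dual ℝ E}
    (hφ : ∀ i, ∀ a ∈ s, ∃ n : ℕ, φ i a = n) :
    ∃ F : Finset α, ∀ i, ∃ f ∈ F, ∀ x ∈ hull ℝ s, φ f x ≤ φ i x := by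
  have := hs.to_subtype
  choose n hn using fun i (a : s) => hφ i a a.2
  obtain ⟨F, hF⟩ := exists_finset_forall_exists_le_of_nat n
  refine ⟨F, fun i => ?_⟩
  obtain ⟨f, hf, hfi⟩ := hF i
  refine ⟨f, hf, fun x hx => sub_nonneg.1 (nonneg_of_mem_hull (φ := φ i - φ f) (fun a ha => ?_) hx)⟩
  rw [LinearMap.sub_apply, hn i ⟨a, ha⟩, hn f ⟨a, ha⟩, sub_nonneg, Nat.cast_le]
  exact hfi ⟨a, ha⟩

theorem eq_zero_of_nonneg_of_mem_interior {E : Type*} [NormedAddCommGroup E] [NormedSpace ℝ E]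
    [FiniteDimensional ℝ E] {φ : Module.Dual ℝ E} {s : Set E} (hφ : ∀ x ∈ s, 0 ≤ φ x) {y : E}
    (hy : y ∈ interior s) (h0 : φ y = 0) : φ = 0 := by
  have hmin : IsLocalMin φ y := by
    filter_upwards [mem_interior_iff_mem_nhds.1 hy] with x hx
    rw [h0]
    exact hφ x hx
  have h := hmin.hasFDerivAt_eq_zero φ.toContinuousLinearMap.hasFDerivAt
  simpa using h

theorem exists_nonempty_interior_of_subset_biUnion {E ι : Type*} [NormedAddCommGroup E]
    [NormedSpace ℝ E] [FiniteDimensional ℝ E] {K : ι → PointedCone ℝ E} {F : Set ι}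
    (hF : F.Countable) {U : Set E} (hU : (interior U).Nonempty) (h : U ⊆ ⋃ i ∈ F, (K i : Set E)) :
    ∃ i ∈ F, (interior (K i : Set E)).Nonempty := by
  by_contra! hne
  have hspan : ∀ i ∈ F, Submodule.span ℝ (K i : Set E) ≠ ⊤ := fun i hi => by
    rw [Ne, ← nonempty_interior_iff_span_eq_top, Set.not_nonempty_iff_eq_empty]
    exact hne i hi
  have hdense : Dense (⋂ i ∈ F, (Submodule.span ℝ (K i : Set E) : Set E)ᶜ) :=
    dense_biInter_of_isOpen
      (fun i _ => (Submodule.closed_of_finiteDimensional _).isOpen_compl) hF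
      fun i hi => dense_compl_of_ne_top (hspan i hi)
  obtain ⟨x, hx, hxU⟩ := hdense.exists_mem_open isOpen_interior hU
  obtain ⟨i, hi, hxi⟩ := Set.mem_iUnion₂.1 (h (interior_subset hxU))
  exact Set.mem_iInter₂.1 hx i hi (Submodule.subset_span hxi)

theorem intrinsicInterior_subset_interior {E : Type*} [NormedAddCommGroup E] [NormedSpace ℝ E]
    {s : Set E} (hs : (interior s).Nonempty) : intrinsicInterior ℝ s ⊆ interior s := by
  have htop : affineSpan ℝ s = ⊤ :=
    top_le_iff.1 ((isOpen_interior.affineSpan_eq_top hs).ge.trans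
      (affineSpan_mono ℝ interior_subset))
  have hopen : IsOpenMap (Subtype.val : affineSpan ℝ s → E) :=
    IsOpen.isOpenMap_subtype_val (by simp [htop])
  exact interior_maximal intrinsicInterior_subset (hopen _ isOpen_interior)

section DirichletCones

variable {V Γ : Type*} [AddCommGroup V] [Module ℝ V] [Group Γ] {ρ : Γ →* (V ≃ₗ[ℝ] V)}
  {ξ : Module.Dual ℝ V} {K : PointedCone ℝ V}

/-- The cone of the points of `K` at which `ξ` is minimal on the `Γ`-orbit, a linear analogue of
the Dirichlet domains of a discrete group. -/
def dirichletCone (ρ : Γ →* (V ≃ₗ[ℝ] V)) (ξ : Module.Dual ℝ V) (K : PointedCone ℝ V) :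
    PointedCone ℝ V :=
  K ⊓ dual .id (Set.range fun γ => ξ ∘ₗ (ρ γ : V →ₗ[ℝ] V) - ξ)

theorem mem_dirichletCone {y : V} :
    y ∈ dirichletCone ρ ξ K ↔ y ∈ K ∧ ∀ γ, ξ y ≤ ξ (ρ γ y) := by
  simp [dirichletCone, Submodule.mem_inf]

section InvariantSubspace

variable {W : Submodule ℝ V} (hρW : ∀ γ, ∀ x ∈ W, ρ γ x ∈ W)
include hρW

theorem subset_dirichletCone_of_nonneg (hξK : ∀ x ∈ K, 0 ≤ ξ x) (hWK : (W : Set V) ⊆ K) :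
    (W : Set V) ⊆ dirichletCone ρ ξ K := fun x hx => by
  have hξW : ∀ w ∈ W, ξ w = 0 := fun w hw =>
    le_antisymm (by simpa using hξK _ (hWK (W.neg_mem hw))) (hξK w (hWK hw))
  exact mem_dirichletCone.2 ⟨hWK hx, fun γ => by rw [hξW x hx, hξW _ (hρW γ x hx)]⟩

theorem image_eq_of_forall_apply_sub_mem {D : PointedCone ℝ V} (hWD : (W : Set V) ⊆ D) {γ : Γ}
    (hγ : ∀ x, ρ γ x - x ∈ W) : ρ γ '' (D : Set V) = D := by
  have hmaps : ∀ γ', (∀ x, ρ γ' x - x ∈ W) → ∀ x ∈ D, ρ γ' x ∈ D := fun γ' h x hx => by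
    simpa using add_mem hx (hWD (h x))
  refine (Set.image_subset_iff.2 (hmaps γ hγ)).antisymm fun x hx => ?_
  refine ⟨ρ γ⁻¹ x, hmaps γ⁻¹ (fun y => ?_) x hx, by simp⟩
  simpa using hρW γ⁻¹ _ (W.neg_mem (hγ y))

end InvariantSubspace

section IntegralGenerators

variable {A : Set V} (hA : ∀ γ, ∀ x ∈ A, ρ γ x ∈ A) (hξA : ∀ x ∈ A, ∃ n : ℕ, ξ x = n)
include hA

theorem apply_mem_hull {x : V} (hx : x ∈ hull ℝ A) (γ : Γ) : ρ γ x ∈ hull ℝ A :=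
  (Submodule.span_le (p := (hull ℝ A).comap (ρ γ : V →ₗ[ℝ] V))).2
    (fun a ha => subset_hull (hA γ a ha)) hx

theorem apply_mem_dirichletCone {s : Set V} (hsA : s ⊆ A) {F : Finset Γ}
    (hF : ∀ γ, ∃ f ∈ F, ∀ x ∈ hull ℝ s, ξ (ρ f x) ≤ ξ (ρ γ x)) {x : V} (hx : x ∈ hull ℝ s) {f : Γ}
    (hf : ∀ g ∈ F, ξ (ρ f x) ≤ ξ (ρ g x)) : ρ f x ∈ dirichletCone ρ ξ (hull ℝ A) := by
  refine mem_dirichletCone.2 ⟨apply_mem_hull hA (Submodule.span_mono hsA hx) f, fun γ => ?_⟩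
  obtain ⟨g, hg, hle⟩ := hF (γ * f)
  simpa using (hf g hg).trans (hle x hx)

include hξA

theorem exists_finset_forall_exists_forall_apply_le {s : Set V} (hs : s.Finite) (hsA : s ⊆ A) :
    ∃ F : Finset Γ, ∀ γ, ∃ f ∈ F, ∀ x ∈ hull ℝ s, ξ (ρ f x) ≤ ξ (ρ γ x) :=
  exists_finset_forall_exists_forall_hull_le (φ := fun γ => ξ ∘ₗ (ρ γ : V →ₗ[ℝ] V)) hs
    fun γ a ha => hξA _ (hA γ a (hsA ha))

theorem exists_finset_forall_exists_apply_mem_dirichletCone {s : Set V} (hs : s.Finite)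
    (hsA : s ⊆ A) :
    ∃ F : Finset Γ, ∀ x ∈ hull ℝ s, ∃ f ∈ F, ρ f x ∈ dirichletCone ρ ξ (hull ℝ A) := by
  obtain ⟨F, hF⟩ := exists_finset_forall_exists_forall_apply_le hA hξA hs hsA
  have hne : F.Nonempty := let ⟨f, hf, _⟩ := hF 1; ⟨f, hf⟩
  refine ⟨F, fun x hx => ?_⟩
  obtain ⟨f, hf, hmin⟩ := F.exists_min_image (fun g => ξ (ρ g x)) hne
  exact ⟨f, hf, apply_mem_dirichletCone hA hsA hF hx hmin⟩

theorem iUnion_image_dirichletCone :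
    ⋃ γ, ρ γ '' (dirichletCone ρ ξ (hull ℝ A) : Set V) = hull ℝ A := by
  refine (Set.iUnion_subset fun γ => Set.image_subset_iff.2 fun y hy =>
    apply_mem_hull hA (mem_dirichletCone.1 hy).1 γ).antisymm fun x hx => ?_
  obtain ⟨s, hsA, hxs⟩ := Submodule.mem_span_finite_of_mem_span hx
  obtain ⟨F, hF⟩ :=
    exists_finset_forall_exists_apply_mem_dirichletCone hA hξA s.finite_toSet hsA
  obtain ⟨f, -, hf⟩ := hF x hxs
  exact Set.mem_iUnion.2 ⟨f⁻¹, ρ f x, hf, by simp⟩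

end IntegralGenerators

end DirichletCones

section DirichletConeInterior

variable {V Γ : Type*} [NormedAddCommGroup V] [NormedSpace ℝ V] [FiniteDimensional ℝ V] [Group Γ]
  {ρ : Γ →* (V ≃ₗ[ℝ] V)} {ξ : Module.Dual ℝ V} {K : PointedCone ℝ V}

theorem forall_apply_eq_of_mem_interior_dirichletCone {γ : Γ} {y : V}
    (hy : y ∈ interior (dirichletCone ρ ξ K : Set V)) (h : ξ (ρ γ y) = ξ y) (x : V) :
    ξ (ρ γ x) = ξ x := by
  have hzero : ξ ∘ₗ (ρ γ : V →ₗ[ℝ] V) - ξ = 0 :=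
    eq_zero_of_nonneg_of_mem_interior
      (fun x hx => sub_nonneg.2 ((mem_dirichletCone.1 hx).2 γ)) hy (sub_eq_zero.2 h)
  exact LinearMap.congr_fun (sub_eq_zero.1 hzero) x

theorem forall_apply_eq_of_mem_image_dirichletCone {γ : Γ} {y : V}
    (hy : y ∈ interior (dirichletCone ρ ξ K : Set V))
    (hγy : y ∈ ρ γ '' (dirichletCone ρ ξ K : Set V)) (x : V) : ξ (ρ γ x) = ξ x := by
  obtain ⟨z, hz, rfl⟩ := hγy
  have hle : ξ (ρ γ z) ≤ ξ z := by
    simpa using (mem_dirichletCone.1 (interior_subset hy)).2 γ⁻¹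
  have h : ξ (ρ γ⁻¹ (ρ γ z)) = ξ (ρ γ z) := by
    simpa using le_antisymm ((mem_dirichletCone.1 hz).2 γ) hle
  simpa using (forall_apply_eq_of_mem_interior_dirichletCone hy h (ρ γ x)).symm

theorem exists_apply_eq_of_mem_interior_dirichletCone {W : Submodule ℝ V}
    (hρW : ∀ γ, ∀ x ∈ W, ρ γ x ∈ W) (hξW : ∀ γ, (∀ x, ξ (ρ γ x) = ξ x) → ∀ x, ρ γ x - x ∈ W)
    {Q : PointedCone ℝ V} (hWQ : (W : Set V) ⊆ Q)
    (hcover : interior (K : Set V) ⊆ ⋃ γ, ρ γ '' (Q : Set V)) {F : Finset Γ}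
    (hF : ∀ γ, ∃ f ∈ F, ∀ x ∈ Q, ξ (ρ f x) ≤ ξ (ρ γ x)) {y : V}
    (hy : y ∈ interior (dirichletCone ρ ξ K : Set V)) :
    ∃ f ∈ F, ∃ x ∈ Q, (∀ g, ξ (ρ f x) ≤ ξ (ρ g x)) ∧ ρ f x = y := by
  have hyD := mem_dirichletCone.1 (interior_subset hy)
  have hyK : y ∈ interior (K : Set V) := interior_mono inf_le_left hy
  obtain ⟨γ, q, hq, rfl⟩ := Set.mem_iUnion.1 (hcover hyK)
  obtain ⟨f, hf, hle⟩ := hF γ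
  have heq : ξ (ρ (f * γ⁻¹) (ρ γ q)) = ξ (ρ γ q) :=
    le_antisymm (by simpa using hle q hq) (hyD.2 _)
  have hW : ρ f q - ρ γ q ∈ W := by
    simpa using hξW _ (forall_apply_eq_of_mem_interior_dirichletCone hy heq) (ρ γ q)
  refine ⟨f, hf, ρ f⁻¹ (ρ γ q), ?_, fun g => ?_, by simp⟩
  · have hmem : q + ρ f⁻¹ (-(ρ f q - ρ γ q)) ∈ Q :=
      add_mem hq (hWQ (hρW _ _ (W.neg_mem hW)))
    simpa using hmem
  · simpa using hyD.2 (g * f⁻¹)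

section Stabilizers

variable {W : Submodule ℝ V} (hρW : ∀ γ, ∀ x ∈ W, ρ γ x ∈ W)
  (hWD : (W : Set V) ⊆ dirichletCone ρ ξ K)
  (hξW : ∀ γ, (∀ x, ξ (ρ γ x) = ξ x) → ∀ x, ρ γ x - x ∈ W)
  (hD : (interior (dirichletCone ρ ξ K : Set V)).Nonempty)
include hρW hWD hξW hD

theorem image_dirichletCone_eq_iff {γ : Γ} :
    ρ γ '' (dirichletCone ρ ξ K : Set V) = dirichletCone ρ ξ K ↔ ∀ x, ρ γ x - x ∈ W := by
  refine ⟨fun h => ?_, image_eq_of_forall_apply_sub_mem hρW hWD⟩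
  obtain ⟨y, hy⟩ := hD
  exact hξW γ (forall_apply_eq_of_mem_image_dirichletCone hy (h.ge (interior_subset hy)))

theorem image_dirichletCone_inter_intrinsicInterior_eq_empty_or (γ : Γ) :
    ρ γ '' (dirichletCone ρ ξ K : Set V) ∩ intrinsicInterior ℝ (dirichletCone ρ ξ K : Set V) = ∅ ∨
      ρ γ '' (dirichletCone ρ ξ K : Set V) = dirichletCone ρ ξ K := by
  refine (Set.eq_empty_or_nonempty _).imp_right fun ⟨y, hγy, hy⟩ => ?_
  exact image_eq_of_forall_apply_sub_mem hρW hWD <| hξW γ <|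
    forall_apply_eq_of_mem_image_dirichletCone (intrinsicInterior_subset_interior hD hy) hγy

end Stabilizers

section IntegralGenerators

variable {A : Set V} (hA : ∀ γ, ∀ x ∈ A, ρ γ x ∈ A) (hξA : ∀ x ∈ A, ∃ n : ℕ, ξ x = n)
include hA hξA

theorem nonempty_interior_dirichletCone (hspan : Submodule.span ℝ A = ⊤) :
    (interior (dirichletCone ρ ξ (hull ℝ A) : Set V)).Nonempty := by
  obtain ⟨s, hsA, hs⟩ := (Submodule.fg_span_iff_fg_span_finset_subset A).1
    (IsNoetherian.noetherian (Submodule.span ℝ A))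
  obtain ⟨F, hF⟩ :=
    exists_finset_forall_exists_apply_mem_dirichletCone hA hξA s.finite_toSet hsA
  have hint : (interior (hull ℝ (s : Set V) : Set V)).Nonempty := by
    rw [nonempty_interior_iff_span_eq_top, hull, Submodule.span_span_of_tower, ← hs, hspan]
  obtain ⟨f, -, y, hy⟩ := exists_nonempty_interior_of_subset_biUnion
    (K := fun f => (dirichletCone ρ ξ (hull ℝ A)).comap (ρ f : V →ₗ[ℝ] V))
    F.countable_toSet hint fun x hx => by simpa using hF x hx
  have hpre := (ρ f).toContinuousLinearEquiv.toHomeomorph.preimage_interior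
    (dirichletCone ρ ξ (hull ℝ A) : Set V)
  exact ⟨ρ f y, hpre.ge hy⟩

theorem isRationalPolyhedralCone_dirichletCone {L : Submodule ℤ V}
    (hρL : ∀ γ, ∀ x ∈ L, ρ γ x ∈ L) (hAL : A ⊆ L) (hξL : ξ ∈ dualLattice L)
    (hspan : Submodule.span ℝ A = ⊤) {W : Submodule ℝ V} (hρW : ∀ γ, ∀ x ∈ W, ρ γ x ∈ W)
    (hξW : ∀ γ, (∀ x, ξ (ρ γ x) = ξ x) → ∀ x, ρ γ x - x ∈ W)
    {s : Set V} (hs : s.Finite) (hsA : s ⊆ A) (hWs : (W : Set V) ⊆ hull ℝ s)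
    (hcover : interior (hull ℝ A : Set V) ⊆ ⋃ γ, ρ γ '' (hull ℝ s : Set V)) :
    IsRationalPolyhedralCone L (dirichletCone ρ ξ (hull ℝ A) : Set V) := by
  obtain ⟨F, hF⟩ := exists_finset_forall_exists_forall_apply_le hA hξA hs hsA
  let T (f : Γ) : Set (Module.Dual ℝ V) :=
    (fun g => ξ ∘ₗ (ρ g : V →ₗ[ℝ] V) - ξ ∘ₗ (ρ f : V →ₗ[ℝ] V)) '' (F : Set Γ)
  let R : PointedCone ℝ V := F.sup fun f => (hull ℝ s ⊓ dual .id (T f)).map (ρ f : V →ₗ[ℝ] V)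
  have hRpoly : IsRationalPolyhedralCone L (R : Set V) := by
    refine .finset_sup F fun f _ => .map (.inf_dual (.of_finite hs ?_) ?_ ?_) (hρL f)
    · exact (hsA.trans hAL).trans subset_ratPoints
    · exact F.finite_toSet.image _
    · exact Set.image_subset_iff.2 fun g _ => sub_mem (comp_mem_dualLattice (hρL g) hξL)
        (comp_mem_dualLattice (hρL f) hξL)
  have hRD : R ≤ dirichletCone ρ ξ (hull ℝ A) := by
    refine Finset.sup_le fun f _ => ?_
    rintro _ ⟨x, ⟨hxs, hxT⟩, rfl⟩
    exact apply_mem_dirichletCone hA hsA hF hxs fun g hg => sub_nonneg.1 (hxT ⟨g, hg, rfl⟩)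
  -- Only interior points are known to lie in a translate of `hull ℝ s`, so the reverse inclusion
  -- holds on the interior first and extends to the closure because `R` is closed.
  have hDR : interior (dirichletCone ρ ξ (hull ℝ A) : Set V) ⊆ R := fun y hy => by
    obtain ⟨f, hf, x, hx, hmin, rfl⟩ :=
      exists_apply_eq_of_mem_interior_dirichletCone hρW hξW hWs hcover hF hy
    refine Finset.le_sup (f := fun f => (hull ℝ s ⊓ dual .id (T f)).map (ρ f : V →ₗ[ℝ] V)) hf
      ⟨x, ⟨hx, ?_⟩, rfl⟩
    rintro _ ⟨g, -, rfl⟩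
    exact sub_nonneg.2 (hmin g)
  have hDint := nonempty_interior_dirichletCone hA hξA hspan
  convert! hRpoly using 1
  refine subset_antisymm ?_ hRD
  calc (dirichletCone ρ ξ (hull ℝ A) : Set V)
      ⊆ closure (interior (dirichletCone ρ ξ (hull ℝ A) : Set V)) := by
        rw [(PointedCone.convex _).closure_interior_eq_closure_of_nonempty_interior hDint]
        exact subset_closure
    _ ⊆ R := closure_minimal hDR hRpoly.isClosed

end IntegralGenerators

end DirichletConeInterior

section Reduction

theorem ratPoints_map {E F : Type*} [AddCommGroup E] [Module ℝ E] [AddCommGroup F] [Module ℝ F]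
    (f : E →ₗ[ℝ] F) (L : Submodule ℤ E) :
    ratPoints (L.map (f.restrictScalars ℤ)) = f '' ratPoints L := by
  refine subset_antisymm ?_ ?_
  · rintro y ⟨n, hn, l, hl, hly⟩
    have hn' : (n : ℝ) ≠ 0 := Nat.cast_ne_zero.2 hn.ne'
    refine ⟨(n : ℝ)⁻¹ • l, ⟨n, hn, ?_⟩, ?_⟩
    · rwa [← Nat.cast_smul_eq_nsmul ℝ, smul_inv_smul₀ hn']
    · rw [map_smul, inv_smul_eq_iff₀ hn', Nat.cast_smul_eq_nsmul]
      exact hly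
  · rintro _ ⟨x, ⟨n, hn, hx⟩, rfl⟩
    exact ⟨n, hn, n • x, hx, map_nsmul f n x⟩

theorem convexHull_eq_hull_of_forall_nsmul_mem {E : Type*} [AddCommGroup E] [Module ℝ E]
    {S : Set E} (h0 : 0 ∈ S) (hS : ∀ n : ℕ, ∀ x ∈ S, n • x ∈ S) :
    convexHull ℝ S = hull ℝ S := by
  refine (convexHull_min subset_hull (hull ℝ S).convex).antisymm fun x hx => ?_
  have h0' : 0 ∈ convexHull ℝ S := subset_convexHull ℝ S h0
  have hsmul : ∀ c : ℝ, 0 ≤ c → ∀ x ∈ convexHull ℝ S, c • x ∈ convexHull ℝ S := by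
    intro c hc x hx
    obtain ⟨n, hn⟩ := exists_nat_gt c
    have hn0 : (0 : ℝ) < n := hc.trans_lt hn
    have hnx : n • x ∈ convexHull ℝ S :=
      convexHull_min (t := DistribSMul.toLinearMap ℝ E n ⁻¹' convexHull ℝ S)
        (fun y hy => subset_convexHull ℝ S (hS n y hy))
        ((convex_convexHull ℝ S).linear_preimage _) hx
    have hmem := (convex_convexHull ℝ S).smul_mem_of_zero_mem h0' hnx
      ⟨div_nonneg hc hn0.le, (div_le_one hn0).2 hn.le⟩
    rwa [← Nat.cast_smul_eq_nsmul ℝ, smul_smul, div_mul_cancel₀ _ hn0.ne'] at hmem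
  induction hx using Submodule.span_induction with
  | mem x hx => exact subset_convexHull ℝ S hx
  | zero => exact h0'
  | add x y _ _ hx hy =>
    have hmid := hsmul 2 zero_le_two _ ((convex_convexHull ℝ S).midpoint_mem hx hy)
    rwa [two_smul, midpoint_add_self] at hmid
  | smul c x _ hx => exact hsmul c c.2 x hx

theorem conePlus_eq_hull {E : Type*} [AddCommGroup E] [Module ℝ E] [TopologicalSpace E]
    (L : Submodule ℤ E) {C : Set E} {K : PointedCone ℝ E} (hK : (K : Set E) = closure C) :
    conePlus L C = hull ℝ ((K : Set E) ∩ ratPoints L) := by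
  rw [conePlus, ← hK, convexHull_eq_hull_of_forall_nsmul_mem]
  · exact ⟨K.zero_mem, subset_ratPoints L.zero_mem⟩
  · rintro n x ⟨hx, m, hm, hmx⟩
    exact ⟨nsmul_mem hx n, m, hm, by rw [smul_comm]; exact nsmul_mem hmx n⟩

theorem hull_inter_ratPoints {E : Type*} [AddCommGroup E] [Module ℝ E] (K : PointedCone ℝ E)
    (L : Submodule ℤ E) : hull ℝ ((K : Set E) ∩ ratPoints L) = hull ℝ ((K : Set E) ∩ L) := by
  refine le_antisymm (Submodule.span_le.2 ?_)
    (Submodule.span_mono (Set.inter_subset_inter_right _ subset_ratPoints))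
  rintro x ⟨hx, n, hn, hnx⟩
  exact (nsmul_mem_iff_of_pointedCone hn).1 (subset_hull ⟨nsmul_mem hx n, hnx⟩)

theorem exists_finset_subset_image_hull {E F : Type*} [AddCommGroup E] [Module ℝ E]
    [AddCommGroup F] [Module ℝ F] (f : E →ₗ[ℝ] F) {A : Set E} {P : Set F} (hP : IsPolyhedralCone P)
    (hPA : P ⊆ f '' (hull ℝ A : Set E)) :
    ∃ s : Finset E, (s : Set E) ⊆ A ∧ P ⊆ f '' (hull ℝ (s : Set E) : Set E) := by
  classical
  have himage : ∀ B : Set E, f '' (hull ℝ B : Set E) = hull ℝ (f '' B) := fun B =>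
    congrArg SetLike.coe (Submodule.map_span (f.restrictScalars {c : ℝ // 0 ≤ c}) B)
  obtain ⟨t, rfl⟩ := hP
  obtain ⟨T, hTA, htT⟩ := Submodule.subset_span_finite_of_subset_span
    ((subset_hull.trans hPA).trans (himage A).le)
  obtain ⟨s, hsA, rfl⟩ := Finset.subset_set_image_iff.1 hTA
  rw [Finset.coe_image] at htT
  have hle : hull ℝ (t : Set F) ≤ hull ℝ (f '' s) := Submodule.span_le.2 htT
  exact ⟨s, hsA, (SetLike.coe_subset_coe.2 hle).trans (himage s).ge⟩

theorem IsMaximalSubspace.mem_iff {V : Type*} [AddCommGroup V] [Module ℝ V] [TopologicalSpace V]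
    {C : Set V} {K : PointedCone ℝ V} (hK : (K : Set V) = closure C) {W : Submodule ℝ V}
    (hW : IsMaximalSubspace C W) {x : V} : x ∈ W ↔ x ∈ K ∧ -x ∈ K := by
  rw [IsMaximalSubspace, ← hK] at hW
  refine ⟨fun hx => ⟨hW.1 hx, hW.1 (W.neg_mem hx)⟩, fun hx => ?_⟩
  exact hW.2 (lineal_le K) (mem_lineal.2 hx)

theorem subset_iUnion_image_of_image_mkQ_subset {V Γ : Type*} [AddCommGroup V] [Module ℝ V]
    [Group Γ] {ρ : Γ →* (V ≃ₗ[ℝ] V)} {W : Submodule ℝ V} (hρW : ∀ γ, W.map (ρ γ : V →ₗ[ℝ] V) = W)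
    {C : Set V} {Q : PointedCone ℝ V} (hWQ : (W : Set V) ⊆ Q)
    (h : W.mkQ '' C ⊆ ⋃ γ, quotientAction ρ W hρW γ '' (W.mkQ '' (Q : Set V))) :
    C ⊆ ⋃ γ, ρ γ '' (Q : Set V) := fun x hx => by
  obtain ⟨γ, _, ⟨z, hz, rfl⟩, hzx⟩ := Set.mem_iUnion.1 (h ⟨x, hx, rfl⟩)
  have hxz : x - ρ γ z ∈ W := (Submodule.Quotient.eq W).1 hzx.symm
  have hw : ρ γ⁻¹ (x - ρ γ z) ∈ W := (hρW γ⁻¹).le ⟨_, hxz, rfl⟩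
  exact Set.mem_iUnion.2 ⟨γ, z + ρ γ⁻¹ (x - ρ γ z), add_mem hz (hWQ hw), by simp⟩

theorem forall_quotientAction_eq_self_iff {V Γ : Type*} [AddCommGroup V] [Module ℝ V] [Group Γ]
    {ρ : Γ →* (V ≃ₗ[ℝ] V)} {W : Submodule ℝ V} (hρW : ∀ γ, W.map (ρ γ : V →ₗ[ℝ] V) = W) {γ : Γ} :
    (∀ x : V ⧸ W, quotientAction ρ W hρW γ x = x) ↔ ∀ x, ρ γ x - x ∈ W :=
  W.mkQ_surjective.forall.trans (forall_congr' fun _ => Submodule.Quotient.eq W)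

variable {V : Type*} [NormedAddCommGroup V] [NormedSpace ℝ V]

theorem exists_properCone_coe_eq_closure {C : ConvexCone ℝ V} (hC : (C : Set V).Nonempty) :
    ∃ K : ProperCone ℝ V, (K : Set V) = closure (C : Set V) :=
  ⟨⟨C.closure.toPointedCone (ConvexCone.Pointed.of_nonempty_of_isClosed
    (hC.mono subset_closure) isClosed_closure), isClosed_closure⟩, rfl⟩

theorem mem_closure_of_mkQ_mem_closure {C : Set V} {K : PointedCone ℝ V}
    (hK : (K : Set V) = closure C) {W : Submodule ℝ V} (hW : (W : Set V) ⊆ K) {x : V}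
    (hx : W.mkQ x ∈ closure (W.mkQ '' C)) : x ∈ K := by
  have hx' : x ∈ closure (W.mkQ ⁻¹' (W.mkQ '' C)) :=
    W.isOpenMap_mkQ.preimage_closure_subset_closure_preimage hx
  refine closure_minimal ?_ (hK ▸ isClosed_closure) hx'
  rintro y ⟨c, hc, hcy⟩
  have hyc : y - c ∈ W := (Submodule.Quotient.eq W).1 hcy.symm
  simpa using add_mem (hK.ge (subset_closure hc) : c ∈ K) (hW hyc)

theorem conePlus_quotientLattice_subset (L : Submodule ℤ V) {C : Set V} {K : PointedCone ℝ V}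
    (hK : (K : Set V) = closure C) {W : Submodule ℝ V} (hW : (W : Set V) ⊆ K) :
    conePlus (quotientLattice L W) (W.mkQ '' C) ⊆ W.mkQ '' conePlus L C := by
  rw [conePlus, conePlus, quotientLattice, ratPoints_map, W.mkQ.image_convexHull]
  refine convexHull_mono ?_
  rintro _ ⟨hx, x, hxL, rfl⟩
  exact ⟨x, ⟨hK.le (mem_closure_of_mkQ_mem_closure hK hW hx), hxL⟩, rfl⟩

theorem exists_isRationalPolyhedralCone_subset_iUnion_image [FiniteDimensional ℝ V]
    {L : Submodule ℤ V} {Γ : Type*} [Group Γ] {ρ : Γ →* (V ≃ₗ[ℝ] V)} {W : Submodule ℝ V}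
    (hρW : ∀ γ, W.map (ρ γ : V →ₗ[ℝ] V) = W) (hW : IsDefinedOverRat L W) {C : Set V}
    {K : PointedCone ℝ V} (hK : (K : Set V) = closure C) (hWK : (W : Set V) ⊆ K)
    (hpoly : IsPolyhedralType (quotientLattice L W) (W.mkQ '' C)
      (quotientAction ρ W hρW).range.subtype) :
    ∃ Q : PointedCone ℝ V, IsRationalPolyhedralCone L (Q : Set V) ∧ Q ≤ K ∧ (W : Set V) ⊆ Q ∧
      C ⊆ ⋃ γ, ρ γ '' (Q : Set V) := by
  obtain ⟨P, hP, hPC, hcover⟩ := hpoly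
  replace hPC := hPC.trans (conePlus_quotientLattice_subset L hK hWK)
  rw [conePlus_eq_hull L hK] at hPC
  obtain ⟨s, hs, hPs⟩ := exists_finset_subset_image_hull W.mkQ hP hPC
  have hsQ : hull ℝ (s : Set V) ≤ hull ℝ (s : Set V) ⊔ ofSubmodule W := le_sup_left
  have hWQ : ofSubmodule W ≤ hull ℝ (s : Set V) ⊔ ofSubmodule W := le_sup_right
  refine ⟨hull ℝ (s : Set V) ⊔ ofSubmodule W, ?_, ?_, hWQ,
    subset_iUnion_image_of_image_mkQ_subset hρW hWQ fun x hx => ?_⟩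
  · exact .sup (.of_finite s.finite_toSet (hs.trans Set.inter_subset_right))
      hW.isRationalPolyhedralCone
  · exact sup_le (Submodule.span_le.2 (hs.trans Set.inter_subset_left)) hWK
  · obtain ⟨⟨_, γ, rfl⟩, y, hy, hyx⟩ := Set.mem_iUnion.1 (hcover hx)
    exact Set.mem_iUnion.2 ⟨γ, y, Set.image_mono hsQ (hPs hy), hyx⟩

theorem exists_mem_dualLattice_forall_apply_sub_mem [FiniteDimensional ℝ V] {L : Submodule ℤ V}
    [DiscreteTopology L] [IsZLattice ℝ L] {K : ProperCone ℝ V} {W : Submodule ℝ V}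
    (hWL : IsDefinedOverRat L W) (hWK : ∀ x, x ∈ W ↔ x ∈ K ∧ -x ∈ K)
    (hspan : Submodule.span ℝ ((K : Set V) ∩ L) = ⊤) {Γ : Type*} [Group Γ]
    {ρ : Γ →* (V ≃ₗ[ℝ] V)} (hρ : ∀ γ, ∀ x ∈ (K : Set V) ∩ L, ρ γ x ∈ (K : Set V) ∩ L) :
    ∃ ξ ∈ dualLattice L, (∀ x ∈ K, 0 ≤ ξ x) ∧
      ∀ γ, (∀ x, ξ (ρ γ x) = ξ x) → ∀ x, ρ γ x - x ∈ W := by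
  obtain ⟨s, hsA, hs⟩ := (Submodule.fg_span_iff_fg_span_finset_subset ((K : Set V) ∩ L)).1
    (IsNoetherian.noetherian (Submodule.span ℝ _))
  obtain ⟨ξ, hξL, hξK, hξ⟩ :=
    exists_mem_dualLattice_forall_apply_eq_imp_sub_mem hWL hWK s.finite_toSet
  refine ⟨ξ, hξL, hξK, fun γ hγ x => ?_⟩
  have hsW : ∀ a ∈ (s : Set V), a ∈ W.comap ((ρ γ : V →ₗ[ℝ] V) - LinearMap.id) := fun a ha =>
    hξ a ha (ρ γ a) (hρ γ a (hsA ha)).1 (hρ γ a (hsA ha)).2 (hγ a)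
  exact Submodule.span_le.2 hsW (hs ▸ hspan ▸ Submodule.mem_top)

theorem apply_mem_closure_of_image_eq [FiniteDimensional ℝ V] {f : V ≃ₗ[ℝ] V} {C : Set V}
    (hf : f '' C = C) {x : V} (hx : x ∈ closure C) : f x ∈ closure C := by
  have h := image_closure_subset_closure_image
    (LinearMap.continuous_of_finiteDimensional (f : V →ₗ[ℝ] V)) ⟨x, hx, rfl⟩
  exact (congrArg closure hf).le h

theorem interior_closure_subset_of_isOpen {C : Set V} (hC : Convex ℝ C) (hCopen : IsOpen C)
    (hCne : C.Nonempty) : interior (closure C) ⊆ C := by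
  have h := hC.interior_closure_eq_interior_of_nonempty_interior (by rwa [hCopen.interior_eq])
  rw [h, hCopen.interior_eq]

theorem span_eq_top_of_isOpen_of_subset_hull {U A : Set V} (hU : IsOpen U) (hne : U.Nonempty)
    (h : U ⊆ hull ℝ A) : Submodule.span ℝ A = ⊤ := by
  refine Submodule.eq_top_of_nonempty_interior' _ (hne.mono (interior_maximal (h.trans ?_) hU))
  exact Submodule.span_subset_span _ ℝ A

theorem exists_isRationalPolyhedralCone_iUnion_image_eq_hull [FiniteDimensional ℝ V]
    {L : Submodule ℤ V} [DiscreteTopology L] [IsZLattice ℝ L] {K : ProperCone ℝ V}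
    (hK : (interior (K : Set V)).Nonempty) {W : Submodule ℝ V} (hWL : IsDefinedOverRat L W)
    (hWK : ∀ x, x ∈ W ↔ x ∈ K ∧ -x ∈ K) {Γ : Type*} [Group Γ] {ρ : Γ →* (V ≃ₗ[ℝ] V)}
    (hρL : ∀ γ, ∀ x ∈ L, ρ γ x ∈ L) (hρK : ∀ γ, ∀ x ∈ K, ρ γ x ∈ K) {Q : PointedCone ℝ V}
    (hQ : IsRationalPolyhedralCone L (Q : Set V)) (hQK : Q ≤ K) (hWQ : (W : Set V) ⊆ Q)
    (hKQ : interior (K : Set V) ⊆ ⋃ γ, ρ γ '' (Q : Set V)) :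
    ∃ D : PointedCone ℝ V, IsRationalPolyhedralCone L (D : Set V) ∧
      ⋃ γ, ρ γ '' (D : Set V) = hull ℝ ((K : Set V) ∩ L) ∧
      (∀ γ, ρ γ '' (D : Set V) ∩ intrinsicInterior ℝ (D : Set V) = ∅ ∨ ρ γ '' (D : Set V) = D) ∧
      ∀ γ, ρ γ '' (D : Set V) = D ↔ ∀ x, ρ γ x - x ∈ W := by
  obtain ⟨s, hs, hsL, rfl⟩ := hQ.exists_generators
  have hρW : ∀ γ, ∀ x ∈ W, ρ γ x ∈ W := fun γ x hx => (hWK _).2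
    ⟨hρK γ x ((hWK x).1 hx).1, by simpa using hρK γ (-x) ((hWK x).1 hx).2⟩
  have hA : ∀ γ, ∀ x ∈ (K : Set V) ∩ L, ρ γ x ∈ (K : Set V) ∩ L := fun γ x hx =>
    ⟨hρK γ x hx.1, hρL γ x hx.2⟩
  have hsA : s ⊆ (K : Set V) ∩ L := Set.subset_inter (subset_hull.trans hQK) hsL
  have hsK : hull ℝ s ≤ hull ℝ ((K : Set V) ∩ L) := Submodule.span_mono hsA
  have hspan : Submodule.span ℝ ((K : Set V) ∩ L) = ⊤ :=
    span_eq_top_of_isOpen_of_subset_hull isOpen_interior hK <| hKQ.trans <|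
      Set.iUnion_subset fun γ => Set.image_subset_iff.2 fun x hx => apply_mem_hull hA (hsK hx) γ
  obtain ⟨ξ, hξL, hξK, hξW⟩ := exists_mem_dualLattice_forall_apply_sub_mem hWL hWK hspan hA
  have hξA : ∀ x ∈ (K : Set V) ∩ L, ∃ n : ℕ, ξ x = n := fun x hx =>
    exists_nat_of_mem_dualLattice hξL hx.2 (hξK x hx.1)
  have hDint := nonempty_interior_dirichletCone hA hξA hspan
  have hWD : (W : Set V) ⊆ dirichletCone ρ ξ (hull ℝ ((K : Set V) ∩ L)) :=
    subset_dirichletCone_of_nonneg hρW (fun _ => nonneg_of_mem_hull fun a ha => hξK a ha.1)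
      (hWQ.trans hsK)
  have hcover : interior (hull ℝ ((K : Set V) ∩ L) : Set V) ⊆ ⋃ γ, ρ γ '' (hull ℝ s : Set V) :=
    (interior_mono (Submodule.span_le (p := (K : PointedCone ℝ V)).2
      Set.inter_subset_left)).trans hKQ
  exact ⟨dirichletCone ρ ξ (hull ℝ ((K : Set V) ∩ L)),
    isRationalPolyhedralCone_dirichletCone hA hξA hρL Set.inter_subset_right hξL hspan hρW hξW
      hs hsA hWQ hcover,
    iUnion_image_dirichletCone hA hξA,
    image_dirichletCone_inter_intrinsicInterior_eq_empty_or hρW hWD hξW hDint,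
    fun _ => image_dirichletCone_eq_iff hρW hWD hξW hDint⟩

end Reduction

theorem proposition3 {V : Type*} [NormedAddCommGroup V] [NormedSpace ℝ V] [FiniteDimensional ℝ V]
    -- the lattice `V(ℤ)` in `V = V(ℤ) ⊗ ℝ`
    (VZ : Submodule ℤ V) [DiscreteTopology VZ] [IsZLattice ℝ VZ]
    {Γ : Type*} [Group Γ] (ρ : Γ →* (V ≃ₗ[ℝ] V))
    (C : ConvexCone ℝ V) (hCopen : IsOpen (C : Set V)) (hCne : (C : Set V).Nonempty)
    (hCinv : ∀ γ, ρ γ '' (C : Set V) = C)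
    -- some lattice in `V(ℚ)` is invariant
    (hLinv : ∃ (L : Submodule ℤ V) (_ : DiscreteTopology L), IsZLattice ℝ L ∧
      (L : Set V) ⊆ ratPoints VZ ∧ ∀ γ, ρ γ '' (L : Set V) = L)
    (W : Submodule ℝ V) (hW : IsMaximalSubspace (C : Set V) W) (hWQ : IsDefinedOverRat VZ W)
    -- the image of `C` in `V ⧸ W`, with the image of `Γ` in `GL(V ⧸ W)`
    (hpoly : IsPolyhedralType (quotientLattice VZ W) (W.mkQ '' (C : Set V))
      (quotientAction ρ W (hW.map_eq hCinv)).range.subtype) :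
    ∃ P : Set V, IsRationalPolyhedralCone VZ P ∧ P ⊆ conePlus VZ (C : Set V) ∧
      (⋃ γ : Γ, ρ γ '' P) = conePlus VZ (C : Set V) ∧
      (∀ γ : Γ, ρ γ '' P ∩ intrinsicInterior ℝ P = ∅ ∨ ρ γ '' P = P) ∧
      {γ : Γ | ρ γ '' P = P} =
        {γ : Γ | ∀ x : V ⧸ W, quotientAction ρ W (hW.map_eq hCinv) γ x = x} := by
  obtain ⟨L, _, _, hLV, hL⟩ := hLinv
  have hrat : ratPoints VZ = ratPoints L := ratPoints_eq_ratPoints hLV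
  have hWL : IsDefinedOverRat L W := by rwa [IsDefinedOverRat, ← hrat]
  obtain ⟨K, hK⟩ := exists_properCone_coe_eq_closure hCne
  have hWK : ∀ x, x ∈ W ↔ x ∈ K ∧ -x ∈ K := fun _ => hW.mem_iff hK
  have hCK : (C : Set V) ⊆ interior (K : Set V) :=
    interior_maximal (subset_closure.trans hK.ge) hCopen
  have hKC : interior (K : Set V) ⊆ C :=
    hK ▸ interior_closure_subset_of_isOpen C.convex hCopen hCne
  have hC : conePlus VZ (C : Set V) = hull ℝ ((K : Set V) ∩ L) := by
    rw [conePlus_eq_hull VZ (K := K) hK, hrat, hull_inter_ratPoints]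
    rfl
  obtain ⟨Q, hQ, hQK, hQW, hCQ⟩ := exists_isRationalPolyhedralCone_subset_iUnion_image
    (hW.map_eq hCinv) hWQ hK (fun x hx => ((hWK x).1 hx).1) hpoly
  obtain ⟨D, hD, hDC, hDinter, hDstab⟩ := exists_isRationalPolyhedralCone_iUnion_image_eq_hull
    (hCne.mono hCK) hWL hWK (fun γ x hx => (hL γ).le ⟨x, hx, rfl⟩)
    (fun γ x hx => hK.ge (apply_mem_closure_of_image_eq (hCinv γ) (hK.le hx)))
    (hQ.mono hrat.le) hQK hQW (hKC.trans hCQ)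
  rw [hC, ← hDC]
  refine ⟨D, hD.mono hrat.ge, fun x hx => Set.mem_iUnion.2 ⟨1, x, hx, by simp⟩, rfl, hDinter, ?_⟩
  simp only [hDstab, forall_quotientAction_eq_self_iff]
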